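/- Let $\mathscr B\subseteq(\mathbb R^{q})^{\mathbb N}$, $q=m+p$, be a discrete-time linear time-invariant system with $m$ inputs, $p\ge 1$ outputs, order (minimal state dimension) $n$ and lag (observability index) $\ell$; that is, $\mathscr B=\ker R(\sigma)$ for a polynomial matrix $R$ and the shift $\sigma$. Write $w_k=(u_k,y_k)$ with $u_k\in\mathbb R^m$, $y_k\in\mathbb R^p$, and let $\mathscr B|_T\subseteq\mathbb R^{qT}$ be the subspace of the (stacked) restrictions of the elements of $\mathscr B$ to the times $0,\dots,T-1$. For $w\in\mathbb R^{qT}$ and $d\le T$ let $\mathscr H_d(w)\in\mathbb R^{qd\times(T-d+1)}$ be the Hankel matrix whose $j$-th column stacks $w_j,\dots,w_{j+d-1}$ ($j=0,\dots,T-d$). Singular values are numbered in decreasing order $s_1\ge s_2\ge\cdots$. Let $L\ge d\ge\ell+1$, $d\le T$ and $md+n>0$. Let $w\in\mathscr B|_T$ and let $\widetilde w_k=w_k+(0,\varepsilon_k)$ be noisy data, $\varepsilon_k\in\mathbb R^p$, $\|\varepsilon_k\|_\infty\le\bar\varepsilon$ for $k=0,\dots,T-1$. Assume $$\operatorname{rank}\mathscr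 H_d(\widetilde w)\ \ge\ \operatorname{rank}\mathscr H_d(w)=md+n .$$ Construct an estimated behavior as follows. 1. Let $\widehat{\mathscr H}$ be a truncated singular value decomposition of $\mathscr H_d(\widetilde w)$ that keeps the $md+n$ leading terms. 2. Let $\widehat R_d\in\mathbb R^{(pd-n)\times qd}$ be a matrix whose rows form an orthonormal basis of the left null space of $\widehat{\mathscr H}$. 3. Let $\widehat\Gamma\in\mathbb R^{(p(L+n)-n)\times q(L+n)}$ be the matrix whose rows are the rows of $[\,\widehat R_d\ \ 0\,]$ and, for $s=1,\dots,L+n-d$, the first $p$ rows of $\widehat R_d$ preceded by $qs$ zeros and followed by $q(L+n-d-s)$ zeros. 4. Let $\widehat P$ be a matrix whose columns form a basis of $\ker\widehat\Gamma$, and put $\widehat{\mathscr B}|_{L+n}:=\operatorname{im}\widehat P$. Put $\delta_1=s_{p(L+n)-n}(\widehat\Gamma)$ and $\delta_2=s_{md+n}(\widehat{\mathscr H})$, and assume that $\delta_1>0$, that is, that $\widehat\Gamma$ has full row rank. Then $\delta_2>0$, the subspaces $\widehat{\mathscr B}|_{L+n}$ and $\mathscr B|_{L+n}$ both have dimension $m(L+n)+n$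 (so that their principal angles $\theta_1,\dots,\theta_{m(L+n)+n}\in[0,\pi/2]$ are defined), and with $\Theta=\operatorname{diag}(\theta_1,\dots,\theta_{m(L+n)+n})$ $$\|\sin\Theta(\widehat{\mathscr B}|_{L+n},\mathscr B|_{L+n})\|_F=\Big(\sum_i\sin^2\theta_i\Big)^{1/2}\le\frac{C_\theta}{\delta_1\delta_2}\,\bar\varepsilon,\qquad C_\theta=8\sqrt{qd\,(L+n-d+1)(md+n)(T-d+1)} .$$ -/

import Mathlib

open Matrix

namespace Behavioral

noncomputable section

/-- Infinite time series (time axis `ℕ`) with values in `ℝ^ι`. -/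
abbrev Signal (ι : Type*) : Type _ := ℕ → ι → ℝ

/-- Trajectories of length `T`, written as stacked vectors in Euclidean space. The entry `(k, v)`
is the value of the variable `v` at time `k`. -/
abbrev Traj (T : ℕ) (ι : Type*) : Type _ := EuclideanSpace ℝ (Fin T × ι)

/-- The shift operator `(σ f)(k) = f (k + 1)` on scalar sequences. -/
def shift : Module.End ℝ (ℕ → ℝ) where
  toFun f := fun k => f (k + 1)
  map_add' _ _ := rfl
  map_smul' _ _ := rfl

/-- `B = ker R(σ)` for the polynomial matrix `R`. -/
def IsKernelRep {ι : Type*} [Fintype ι] {g : ℕ} (B : Submodule ℝ (Signal ι))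
    (R : Matrix (Fin g) ι (Polynomial ℝ)) : Prop :=
  ∀ w : Signal ι, w ∈ B ↔
    ∀ i, ∑ v, (Polynomial.aeval shift (R i v)) (fun k => w k v) = 0

/-- `B` is the set of the signals `w` which, after the reordering `π` of the variables, are
input/output pairs `(u, y)` of `x(t+1) = A x(t) + E u(t)`, `y(t) = C x(t) + D u(t)`. -/
def IsStateRep {m p n : ℕ} (B : Submodule ℝ (Signal (Fin m ⊕ Fin p)))
    (π : Equiv.Perm (Fin m ⊕ Fin p))
    (A : Matrix (Fin n) (Fin n) ℝ) (E : Matrix (Fin n) (Fin m) ℝ)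
    (C : Matrix (Fin p) (Fin n) ℝ) (D : Matrix (Fin p) (Fin m) ℝ) : Prop :=
  ∀ w : Signal (Fin m ⊕ Fin p), w ∈ B ↔
    ∃ x : ℕ → Fin n → ℝ, ∀ t,
      x (t + 1) = A *ᵥ x t + E *ᵥ (fun i => w t (π (Sum.inl i))) ∧
      (fun j => w t (π (Sum.inr j))) = C *ᵥ x t + D *ᵥ (fun i => w t (π (Sum.inl i)))

/-- The observability matrix with block rows `C, C A, …, C A^(k-1)`. -/
def obsMatrix {p n : ℕ} (A : Matrix (Fin n) (Fin n) ℝ) (C : Matrix (Fin p) (Fin n) ℝ) (k : ℕ) :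
    Matrix (Fin k × Fin p) (Fin n) ℝ :=
  Matrix.of fun r j => (C * A ^ (r.1 : ℕ)) r.2 j

/-- The class of linear time-invariant systems with `m` inputs, `p` outputs, order `n` and
lag `l`: the behavior has a kernel representation, `n` is its minimal state dimension, and `l` is
the observability index of a state representation of that dimension. -/
structure IsLTI {m p : ℕ} (n l : ℕ) (B : Submodule ℝ (Signal (Fin m ⊕ Fin p))) : Prop where
  kernelRep : ∃ (g : ℕ) (R : Matrix (Fin g) (Fin m ⊕ Fin p) (Polynomial ℝ)), IsKernelRep B R
  stateRep : ∃ (π : Equiv.Perm (Fin m ⊕ Fin p))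
    (A : Matrix (Fin n) (Fin n) ℝ) (E : Matrix (Fin n) (Fin m) ℝ)
    (C : Matrix (Fin p) (Fin n) ℝ) (D : Matrix (Fin p) (Fin m) ℝ),
    IsStateRep B π A E C D ∧ IsLeast {k : ℕ | (obsMatrix A C k).rank = n} l
  minimal : ∀ (n' : ℕ) (π : Equiv.Perm (Fin m ⊕ Fin p))
    (A : Matrix (Fin n') (Fin n') ℝ) (E : Matrix (Fin n') (Fin m) ℝ)
    (C : Matrix (Fin p) (Fin n') ℝ) (D : Matrix (Fin p) (Fin m) ℝ),
    IsStateRep B π A E C D → n ≤ n'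

/-- The first `T` samples of a signal. -/
def window {ι : Type*} (T : ℕ) : Signal ι →ₗ[ℝ] Traj T ι where
  toFun w := WithLp.toLp 2 fun k => w k.1 k.2
  map_add' _ _ := rfl
  map_smul' _ _ := rfl

/-- The finite-length behavior `B|_T`. -/
def restrict {ι : Type*} (B : Submodule ℝ (Signal ι)) (T : ℕ) : Submodule ℝ (Traj T ι) :=
  B.map (window T)

/-- The Hankel matrix of depth `d` of a trajectory of length `T`, with `T - d + 1` columns. -/
def hankel {ι : Type*} {T d : ℕ} (h : d ≤ T) (w : Traj T ι) :
    Matrix (Fin d × ι) (Fin (T - d + 1)) ℝ :=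
  Matrix.of fun r j => w (⟨r.1 + j, by have := r.1.isLt; have := j.isLt; omega⟩, r.2)

/-- The noisy measurements `w_k + (0, ε_k)` of a trajectory `w_k = (u_k, y_k)`. -/
def addOutputNoise {m p T : ℕ} (w : Traj T (Fin m ⊕ Fin p)) (ε : Fin T → Fin p → ℝ) :
    Traj T (Fin m ⊕ Fin p) :=
  WithLp.toLp 2 fun k => w k + Sum.elim (fun _ => 0) (ε k.1) k.2

/-- The singular value `s_i(M)`, numbered from `i = 1` in decreasing order. -/
def sval {a b : Type*} [Fintype a] [Fintype b] [DecidableEq b] (i : ℕ) (M : Matrix a b ℝ) : ℝ :=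
  (Matrix.toEuclideanLin M).singularValues (i - 1)

/-- `M'` arises from a singular value decomposition `M = U diag(s) Vᵀ` (`U`, `V` with orthonormal
columns, `s` decreasing and nonnegative) by keeping the `k` leading terms only. -/
def IsTruncatedSVD {a b : Type*} [Fintype a] [Fintype b] (k : ℕ) (M M' : Matrix a b ℝ) : Prop :=
  ∃ (U : Matrix a (Fin (min (Fintype.card a) (Fintype.card b))) ℝ)
    (V : Matrix b (Fin (min (Fintype.card a) (Fintype.card b))) ℝ)
    (s : Fin (min (Fintype.card a) (Fintype.card b)) → ℝ),
    Uᵀ * U = 1 ∧ Vᵀ * V = 1 ∧ Antitone s ∧ (∀ i, 0 ≤ s i) ∧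
    M = U * Matrix.diagonal s * Vᵀ ∧
    M' = U * Matrix.diagonal (fun i => if i.val < k then s i else 0) * Vᵀ

/-- The columns of `N` form a basis of `ker M`. -/
def IsNullBasis {a b c : Type*} [Fintype b] [Fintype c] (M : Matrix a b ℝ) (N : Matrix b c ℝ) :
    Prop :=
  LinearIndependent ℝ N.col ∧ LinearMap.range N.mulVecLin = LinearMap.ker M.mulVecLin

/-- The block row `[0 … 0 ρ 0 … 0]` of `N` blocks in which `ρ` is preceded by `s` zero blocks. -/
def shiftedRow {ι : Type*} {d : ℕ} (N s : ℕ) (ρ : Fin d × ι → ℝ) : Fin N × ι → ℝ :=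
  fun k => if h : s ≤ (k.1 : ℕ) ∧ (k.1 : ℕ) - s < d then ρ (⟨k.1 - s, h.2⟩, k.2) else 0

/-- The matrix whose rows are all the rows of `R`, followed by zeros, and the first `p` rows
of `R` shifted by `1, …, N - d` blocks. (The default `0` is for `r < p` only.) -/
def gammaMatrix {ι : Type*} {r d : ℕ} (p N : ℕ) (R : Matrix (Fin r) (Fin d × ι) ℝ) :
    Matrix (Fin r ⊕ Fin (N - d) × Fin p) (Fin N × ι) ℝ :=
  Matrix.of (Sum.elim
    (fun i => shiftedRow N 0 (R i))
    (fun a => shiftedRow N (a.1 + 1) (if h : (a.2 : ℕ) < r then R ⟨a.2, h⟩ else 0)))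

/-- `θ_1, …, θ_k` are the principal angles between the subspaces `X` and `Y` of dimension `k`. -/
def IsPrincipalAngles {κ : Type*} [Fintype κ] {k : ℕ}
    (X Y : Submodule ℝ (EuclideanSpace ℝ κ)) (θ : Fin k → ℝ) : Prop :=
  Module.finrank ℝ X = k ∧ Module.finrank ℝ Y = k ∧
  ∃ x y : Fin k → EuclideanSpace ℝ κ, ∀ i,
    x i ∈ X ∧ y i ∈ Y ∧ ‖x i‖ = 1 ∧ ‖y i‖ = 1 ∧
    (∀ j < i, inner ℝ (x i) (x j) = 0 ∧ inner ℝ (y i) (y j) = 0) ∧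
    0 ≤ θ i ∧ θ i ≤ Real.pi / 2 ∧ Real.cos (θ i) = inner ℝ (x i) (y i) ∧
    ∀ x' ∈ X, ∀ y' ∈ Y, ‖x'‖ = 1 → ‖y'‖ = 1 →
      (∀ j < i, inner ℝ x' (x j) = 0 ∧ inner ℝ y' (y j) = 0) →
      inner ℝ x' y' ≤ Real.cos (θ i)

end

end Behavioral

/-!
The exact and the estimated behavior of length `L + n` have the same dimension, and the estimated
one is `ker Γ̂`. With an orthonormal basis of principal vectors `yᵢ` of the exact behavior, `sin θᵢ`
is the distance of `yᵢ` to `ker Γ̂` (`IsPrincipalAngles.exists_orthonormal`), and the smallest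
positive singular value `δ₁` of `Γ̂` bounds this distance by `‖Γ̂ yᵢ‖ / δ₁`
(`singularValues_mul_norm_le`).

An entry of `Γ̂ yᵢ` is the inner product of a row `ρ` of `R̂` with a window of `yᵢ`. By time
invariance the window lies in the exact behavior `W` of length `d`, so only the component of `ρ` in
`W` counts; Bessel's inequality for each of the `L + n - d + 1` window positions gives
`∑ᵢ ‖Γ̂ yᵢ‖² ≤ (L + n - d + 1) ∑ ‖P_W ρ‖²` (`sum_norm_toEuclideanLin_gammaMatrix_sq_le`).

The rows `ρ` are orthonormal and orthogonal to the image of the truncated Hankel matrix, so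
`∑ ‖P_W ρ‖²` is at most the squared gap between this image and `W`. The two spaces have the same
dimension `md + n`, and the gap between spaces of equal dimension is symmetric, so it can be
measured on the leading left singular vectors `uᵢ = H̃ vᵢ / sᵢ` of the noisy Hankel matrix `H̃`
instead. Since the exact Hankel matrix `H` maps into `W`, the distance of `uᵢ` to `W` is at most
`‖(H̃ - H) vᵢ‖ / δ₂`, and the squares of these sum up to at most `‖H̃ - H‖_F² / δ₂²`
(`IsTruncatedSVD.sum_norm_starProjection_sq_le`). Every entry of `H̃ - H` is at most `ε̄` in modulus,
which yields the bound, with a constant smaller than the one stated.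

Principal angles exist by a greedy choice (`exists_principal_vectors`), and the dimension of the
exact behavior comes from a state representation (`IsStateRep.finrank_restrict`).
-/

namespace Behavioral

/-! ### Principal angles -/

section Geometry

variable {E : Type*} [NormedAddCommGroup E] [InnerProductSpace ℝ E]

lemma norm_starProjection_sq [FiniteDimensional ℝ E] {ι : Type*} [Fintype ι]
    {U : Submodule ℝ E} {u : ι → E} (hu : Orthonormal ℝ u) (hU : ∀ i, u i ∈ U)
    (hdim : Module.finrank ℝ U = Fintype.card ι) (x : E) :
    ‖U.starProjection x‖ ^ 2 = ∑ i, inner ℝ (u i) x ^ 2 := by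
  classical
  let u' : ι → U := fun i => ⟨u i, hU i⟩
  have hu' : Orthonormal ℝ u' := by
    refine ⟨fun i => hu.1 i, fun i j hij => ?_⟩
    simpa [u', Submodule.coe_inner] using hu.2 hij
  have hspan : ⊤ ≤ Submodule.span ℝ (Set.range u') :=
    (hu'.linearIndependent.span_eq_top_of_card_eq_finrank' hdim.symm).ge
  let b := OrthonormalBasis.mk hu' hspan
  have h := b.sum_sq_norm_inner_right (U.orthogonalProjectionOnto x)
  rw [Submodule.starProjection_apply, ← Submodule.coe_norm, ← h]
  refine Finset.sum_congr rfl fun i _ => ?_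
  have : inner ℝ (b i) (U.orthogonalProjectionOnto x) = inner ℝ (u i) x := by
    simp only [b, OrthonormalBasis.coe_mk]
    exact Submodule.inner_orthogonalProjectionOnto_eq_of_mem_left (u' i) x
  rw [this, Real.norm_eq_abs, sq_abs]

lemma norm_sub_starProjection_sq [FiniteDimensional ℝ E] {ι : Type*} [Fintype ι]
    {U : Submodule ℝ E} {u : ι → E} (hu : Orthonormal ℝ u) (hU : ∀ i, u i ∈ U)
    (hdim : Module.finrank ℝ U = Fintype.card ι) (x : E) :
    ‖x - U.starProjection x‖ ^ 2 = ‖x‖ ^ 2 - ∑ i, inner ℝ (u i) x ^ 2 := by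
  have hpyth : ‖x‖ ^ 2 = ‖U.starProjection x‖ ^ 2 + ‖x - U.starProjection x‖ ^ 2 := by
    have h0 : inner ℝ (U.starProjection x) (x - U.starProjection x) = 0 :=
      Submodule.inner_right_of_mem_orthogonal (U.starProjection_apply_mem x)
        (U.sub_starProjection_mem_orthogonal x)
    have := norm_add_sq_eq_norm_sq_add_norm_sq_of_inner_eq_zero _ _ h0
    rw [add_sub_cancel] at this
    simpa [sq] using this
  rw [hpyth, norm_starProjection_sq hu hU hdim]
  ring

lemma norm_sub_starProjection_le [FiniteDimensional ℝ E] {U : Submodule ℝ E} (x : E) {z : E}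
    (hz : z ∈ U) : ‖x - U.starProjection x‖ ≤ ‖x - z‖ := by
  have h : x - U.starProjection x = Uᗮ.starProjection (x - z) := by
    rw [Submodule.starProjection_orthogonal_val, map_sub,
      Submodule.starProjection_eq_self_iff.mpr hz]
    abel
  rw [h]
  exact Uᗮ.norm_starProjection_apply_le _

/-- The gap between two subspaces of equal dimension, measured with orthonormal bases, is
symmetric: both sides are the dimension minus the sum of the squared mutual inner products. -/
lemma sum_norm_sub_starProjection_sq_comm [FiniteDimensional ℝ E] {ι : Type*} [Fintype ι]
    {U V : Submodule ℝ E} {u v : ι → E} (hu : Orthonormal ℝ u) (hU : ∀ i, u i ∈ U)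
    (hUdim : Module.finrank ℝ U = Fintype.card ι) (hv : Orthonormal ℝ v) (hV : ∀ i, v i ∈ V)
    (hVdim : Module.finrank ℝ V = Fintype.card ι) :
    ∑ i, ‖u i - V.starProjection (u i)‖ ^ 2 = ∑ j, ‖v j - U.starProjection (v j)‖ ^ 2 := by
  simp only [norm_sub_starProjection_sq hv hV hVdim, norm_sub_starProjection_sq hu hU hUdim,
    hu.1, hv.1, Finset.sum_sub_distrib]
  rw [Finset.sum_comm]
  simp only [real_inner_comm]

lemma sum_inner_sq_le {ι : Type*} [Fintype ι] {u : ι → E} (hu : Orthonormal ℝ u) (x : E) :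
    ∑ i, inner ℝ (u i) x ^ 2 ≤ ‖x‖ ^ 2 := by
  simpa using hu.sum_inner_products_le (s := Finset.univ) x

/-- If the pair `x`, `y` is optimal among the pairs `(a x + b z, y)`, where `z` is orthogonal
to `x`, then `z` is orthogonal to `y`: the choice `a = ⟪x, y⟫`, `b = ⟪z, y⟫` would give the value
`√(a² + b²)`. -/
lemma inner_eq_zero_of_forall_inner_le {x y z : E}
    (hx1 : ‖x‖ = 1) (hz1 : ‖z‖ = 1) (hxz : inner ℝ x z = 0) (h0 : 0 ≤ inner ℝ x y)
    (hmax : ∀ a b : ℝ, ‖a • x + b • z‖ = 1 → inner ℝ (a • x + b • z) y ≤ inner ℝ x y) :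
    inner ℝ z y = 0 := by
  set a := inner ℝ x y with ha
  set b := inner ℝ z y with hb
  by_contra hb0
  have hpos : 0 < a ^ 2 + b ^ 2 := by positivity
  set r := √(a ^ 2 + b ^ 2) with hr
  have hrpos : 0 < r := Real.sqrt_pos.mpr hpos
  have hrsq : r ^ 2 = a ^ 2 + b ^ 2 := Real.sq_sqrt hpos.le
  have hxx : inner ℝ x x = (1 : ℝ) := by rw [real_inner_self_eq_norm_sq, hx1]; norm_num
  have hzz : inner ℝ z z = (1 : ℝ) := by rw [real_inner_self_eq_norm_sq, hz1]; norm_num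
  have hzx : inner ℝ z x = (0 : ℝ) := by rw [real_inner_comm, hxz]
  have hn : ‖(a / r) • x + (b / r) • z‖ = 1 := by
    rw [← sq_eq_sq₀ (norm_nonneg _) zero_le_one, ← real_inner_self_eq_norm_sq]
    simp only [inner_add_left, inner_add_right, real_inner_smul_left, real_inner_smul_right,
      hxx, hzz, hxz, hzx]
    field_simp
    linarith
  have h := hmax _ _ hn
  rw [inner_add_left, real_inner_smul_left, real_inner_smul_left, ← ha, ← hb] at h
  have h2 : a / r * a + b / r * b = r := by field_simp; linarith
  rw [h2] at h
  have : 0 < b ^ 2 := by positivity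
  nlinarith

/-- Two subspaces of the same dimension have principal vectors: the pairs are chosen greedily,
each as a maximum over the compact set of the pairs of unit vectors orthogonal to the earlier
choices. -/
lemma exists_principal_vectors [FiniteDimensional ℝ E] (k : ℕ) (X Y : Submodule ℝ E)
    (hX : Module.finrank ℝ X = k) (hY : Module.finrank ℝ Y = k) :
    ∃ x y : Fin k → E, ∀ i,
      x i ∈ X ∧ y i ∈ Y ∧ ‖x i‖ = 1 ∧ ‖y i‖ = 1 ∧
      (∀ j < i, inner ℝ (x i) (x j) = 0 ∧ inner ℝ (y i) (y j) = 0) ∧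
      0 ≤ inner ℝ (x i) (y i) ∧
      ∀ x' ∈ X, ∀ y' ∈ Y, ‖x'‖ = 1 → ‖y'‖ = 1 →
        (∀ j < i, inner ℝ x' (x j) = 0 ∧ inner ℝ y' (y j) = 0) →
        inner ℝ x' y' ≤ inner ℝ (x i) (y i) := by
  induction k generalizing X Y with
  | zero => exact ⟨Fin.elim0, Fin.elim0, fun i => i.elim0⟩
  | succ k ih =>
    have hne : ∀ Z : Submodule ℝ E, Module.finrank ℝ Z = k + 1 →
        ∃ z, z ∈ Metric.sphere (0 : E) 1 ∩ (Z : Set E) := by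
      intro Z hZ
      have : Nontrivial Z := Module.nontrivial_of_finrank_pos (R := ℝ) (by omega)
      obtain ⟨z, hz⟩ := exists_ne (0 : Z)
      have hz' : ‖(z : E)‖ ≠ 0 := by simpa using hz
      refine ⟨‖(z : E)‖⁻¹ • (z : E), ?_, Z.smul_mem _ z.2⟩
      rw [mem_sphere_zero_iff_norm, norm_smul, norm_inv, norm_norm, inv_mul_cancel₀ hz']
    have hcpt : ∀ Z : Submodule ℝ E, IsCompact (Metric.sphere (0 : E) 1 ∩ (Z : Set E)) :=
      fun Z => (isCompact_sphere 0 1).inter_right Z.closed_of_finiteDimensional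
    obtain ⟨a, ha⟩ := hne X hX
    obtain ⟨b, hb⟩ := hne Y hY
    obtain ⟨⟨x₀, y₀⟩, ⟨⟨hx₀, hx₀X⟩, hy₀, hy₀Y⟩, hmax⟩ :=
      ((hcpt X).prod (hcpt Y)).exists_isMaxOn ⟨(a, b), ha, hb⟩
        (f := fun z : E × E => inner ℝ z.1 z.2)
        (continuous_fst.inner continuous_snd).continuousOn
    simp only [mem_sphere_zero_iff_norm, SetLike.mem_coe] at hx₀ hy₀ hx₀X hy₀Y
    have hmax' : ∀ x' ∈ X, ∀ y' ∈ Y, ‖x'‖ = 1 → ‖y'‖ = 1 → inner ℝ x' y' ≤ inner ℝ x₀ y₀ := by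
      intro x' hx' y' hy' h1 h2
      exact hmax (a := (x', y')) ⟨⟨by simpa using h1, hx'⟩, by simpa using h2, hy'⟩
    have hdim : ∀ (Z : Submodule ℝ E) (z : E), z ∈ Z → ‖z‖ = 1 → Module.finrank ℝ Z = k + 1 →
        Module.finrank ℝ ((ℝ ∙ z)ᗮ ⊓ Z : Submodule ℝ E) = k := by
      intro Z z hz hz1 hZ
      have h := Submodule.finrank_add_inf_finrank_orthogonal
        (K₁ := ℝ ∙ z) (K₂ := Z) ((Submodule.span_singleton_le_iff_mem z Z).mpr hz)
      rw [finrank_span_singleton (norm_ne_zero_iff.mp (by rw [hz1]; norm_num)), hZ] at h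
      omega
    obtain ⟨x, y, hxy⟩ := ih _ _ (hdim X x₀ hx₀X hx₀ hX) (hdim Y y₀ hy₀Y hy₀ hY)
    refine ⟨Fin.cons x₀ x, Fin.cons y₀ y, fun i => ?_⟩
    induction i using Fin.cases with
    | zero =>
      refine ⟨hx₀X, hy₀Y, hx₀, hy₀, fun j hj => absurd hj (Fin.not_lt_zero j), ?_, ?_⟩
      · simp only [Fin.cons_zero]
        have h := hmax' (-x₀) (X.neg_mem hx₀X) y₀ hy₀Y (by rwa [norm_neg]) hy₀
        rw [inner_neg_left] at h
        linarith
      · intro x' hx' y' hy' h1 h2 _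
        exact hmax' x' hx' y' hy' h1 h2
    | succ i =>
      obtain ⟨h1, h2, h3, h4, h5, h6, h7⟩ := hxy i
      simp only [Fin.cons_succ]
      refine ⟨h1.2, h2.2, h3, h4, fun j hj => ?_, h6, ?_⟩
      · induction j using Fin.cases with
        | zero =>
          simp only [Fin.cons_zero]
          exact ⟨Submodule.mem_orthogonal_singleton_iff_inner_left.mp h1.1,
            Submodule.mem_orthogonal_singleton_iff_inner_left.mp h2.1⟩
        | succ j =>
          simp only [Fin.cons_succ]
          exact h5 j (Fin.succ_lt_succ_iff.mp hj)
      · intro x' hx' y' hy' hx1 hy1 hort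
        have h0 := hort 0 (Fin.succ_pos i)
        simp only [Fin.cons_zero] at h0
        refine h7 x' ⟨Submodule.mem_orthogonal_singleton_iff_inner_left.mpr h0.1, hx'⟩
          y' ⟨Submodule.mem_orthogonal_singleton_iff_inner_left.mpr h0.2, hy'⟩ hx1 hy1
          fun j hj => ?_
        simpa using hort j.succ (Fin.succ_lt_succ_iff.mpr hj)

end Geometry

lemma exists_isPrincipalAngles {κ : Type*} [Fintype κ] {k : ℕ}
    {X Y : Submodule ℝ (EuclideanSpace ℝ κ)} (hX : Module.finrank ℝ X = k)
    (hY : Module.finrank ℝ Y = k) : ∃ θ : Fin k → ℝ, IsPrincipalAngles X Y θ := by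
  obtain ⟨x, y, hxy⟩ := exists_principal_vectors k X Y hX hY
  refine ⟨fun i => Real.arccos (inner ℝ (x i) (y i)), hX, hY, x, y, fun i => ?_⟩
  obtain ⟨h1, h2, h3, h4, h5, h6, h7⟩ := hxy i
  have hcos : Real.cos (Real.arccos (inner ℝ (x i) (y i))) = inner ℝ (x i) (y i) := by
    refine Real.cos_arccos (by linarith) ?_
    simpa [h3, h4] using real_inner_le_norm (x i) (y i)
  refine ⟨h1, h2, h3, h4, h5, Real.arccos_nonneg _, Real.arccos_le_pi_div_two.mpr h6, hcos, ?_⟩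
  rwa [hcos]

/-- Principal angles measure the gap between the subspaces: with the principal vectors `y` of `Y`
as an orthonormal basis, `sin θᵢ` is the distance of `yᵢ` to `X`. -/
lemma IsPrincipalAngles.exists_orthonormal {κ : Type*} [Fintype κ] {k : ℕ}
    {X Y : Submodule ℝ (EuclideanSpace ℝ κ)} {θ : Fin k → ℝ} (h : IsPrincipalAngles X Y θ) :
    ∃ y : Fin k → EuclideanSpace ℝ κ, Orthonormal ℝ y ∧ (∀ i, y i ∈ Y) ∧
      ∀ i, Real.sin (θ i) ^ 2 = ‖y i - X.starProjection (y i)‖ ^ 2 := by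
  obtain ⟨hX, hY, x, y, hxy⟩ := h
  have hort : ∀ i j, i ≠ j → inner ℝ (x i) (x j) = 0 ∧ inner ℝ (y i) (y j) = 0 := by
    intro i j hij
    rcases lt_or_gt_of_ne hij with hlt | hlt
    · have := (hxy j).2.2.2.2.1 i hlt
      rwa [real_inner_comm (x i), real_inner_comm (y i)] at this
    · exact (hxy i).2.2.2.2.1 j hlt
  have hxo : Orthonormal ℝ x := ⟨fun i => (hxy i).2.2.1, fun i j hij => (hort i j hij).1⟩
  have hyo : Orthonormal ℝ y := ⟨fun i => (hxy i).2.2.2.1, fun i j hij => (hort i j hij).2⟩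
  have hnn : ∀ i, 0 ≤ inner ℝ (x i) (y i) := by
    intro i
    obtain ⟨-, -, -, -, -, h0, hπ, hcos, -⟩ := hxy i
    rw [← hcos]
    exact Real.cos_nonneg_of_neg_pi_div_two_le_of_le (by linarith [Real.pi_pos]) hπ
  -- Optimality of the pair with the smaller index makes the mixed inner products vanish.
  have hcross : ∀ i j, i < j → inner ℝ (x j) (y i) = 0 ∧ inner ℝ (x i) (y j) = 0 := by
    intro i j hij
    obtain ⟨hxX, hyY, hx1, hy1, hprev, -, -, hcos, hmax⟩ := hxy i
    rw [hcos] at hmax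
    constructor
    · refine inner_eq_zero_of_forall_inner_le hx1 (hxo.1 j) (hort i j hij.ne).1
        (hnn i) fun a b hab => hmax _ (X.add_mem (X.smul_mem _ hxX) (X.smul_mem _ (hxy j).1))
          _ hyY hab hy1 fun t ht => ⟨?_, (hprev t ht).2⟩
      rw [inner_add_left, real_inner_smul_left, real_inner_smul_left, (hprev t ht).1,
        (hort j t (ht.trans hij).ne').1]
      ring
    · rw [real_inner_comm]
      refine inner_eq_zero_of_forall_inner_le hy1 (hyo.1 j) (hort i j hij.ne).2
        (by rw [real_inner_comm]; exact hnn i) fun a b hab => ?_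
      rw [real_inner_comm, real_inner_comm (x i)]
      refine hmax _ hxX _ (Y.add_mem (Y.smul_mem _ hyY) (Y.smul_mem _ (hxy j).2.1)) hx1 hab
        fun t ht => ⟨(hprev t ht).1, ?_⟩
      rw [inner_add_left, real_inner_smul_left, real_inner_smul_left, (hprev t ht).2,
        (hort j t (ht.trans hij).ne').2]
      ring
  refine ⟨y, hyo, fun i => (hxy i).2.1, fun i => ?_⟩
  rw [norm_sub_starProjection_sq hxo (fun i => (hxy i).1) (by simpa using hX), hyo.1 i,
    Finset.sum_eq_single i, Real.sin_sq, (hxy i).2.2.2.2.2.2.2.1]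
  · norm_num
  · intro j _ hji
    rcases lt_or_gt_of_ne hji with hlt | hlt
    · rw [(hcross j i hlt).2]; norm_num
    · rw [(hcross i j hlt).1]; norm_num
  · intro hi; exact absurd (Finset.mem_univ i) hi

/-! ### Singular values and the truncated singular value decomposition -/

/-- If `T` has rank at most `k + 1`, then its singular value with the (zero-based) number `k` is a
lower bound for `T` on the orthogonal complement of the kernel. -/
lemma singularValues_mul_norm_le {E F : Type*} [NormedAddCommGroup E] [InnerProductSpace ℝ E]
    [FiniteDimensional ℝ E] [NormedAddCommGroup F] [InnerProductSpace ℝ F] [FiniteDimensional ℝ F]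
    (T : E →ₗ[ℝ] F) {k : ℕ} (hk : Module.finrank ℝ T.range ≤ k + 1) {x : E}
    (hx : x ∈ T.kerᗮ) : T.singularValues k * ‖x‖ ≤ ‖T x‖ := by
  by_cases! hkE : Module.finrank ℝ E ≤ k
  · rw [T.singularValues_of_finrank_le hkE, zero_mul]
    exact norm_nonneg _
  have hS := T.isSymmetric_adjoint_comp_self
  set b := hS.eigenvectorBasis rfl with hb
  have heig : ∀ i, (T.adjoint ∘ₗ T) (b i) = (T.singularValues i ^ 2) • b i := by
    intro i
    rw [T.sq_singularValues_fin rfl]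
    exact hS.apply_eigenvectorBasis rfl i
  have hT : ∀ i, inner ℝ (T x) (T (b i)) = T.singularValues i ^ 2 * inner ℝ x (b i) := by
    intro i
    rw [← LinearMap.adjoint_inner_right, ← LinearMap.comp_apply, heig, real_inner_smul_right]
  have hker : ∀ i : Fin _, k < (i : ℕ) → inner ℝ x (b i) = 0 := by
    intro i hi
    refine Submodule.inner_left_of_mem_orthogonal (K := T.ker) ?_ hx
    have h0 : T.singularValues i = 0 :=
      T.singularValues_eq_zero_iff_le_finrank_range.mpr (by omega)
    have h := heig i
    rw [h0, zero_pow two_ne_zero, zero_smul] at h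
    rw [LinearMap.mem_ker, ← inner_self_eq_zero (𝕜 := ℝ), ← LinearMap.adjoint_inner_left,
      ← LinearMap.comp_apply, h, inner_zero_left]
  have hnorm : ‖T x‖ ^ 2 =
      ∑ i : Fin (Module.finrank ℝ E), T.singularValues i ^ 2 * inner ℝ x (b i) ^ 2 := by
    rw [← real_inner_self_eq_norm_sq, ← LinearMap.adjoint_inner_right,
      ← b.sum_inner_mul_inner x]
    refine Finset.sum_congr rfl fun i _ => ?_
    rw [LinearMap.adjoint_inner_right, real_inner_comm (T x), hT]
    ring
  refine le_of_sq_le_sq ?_ (norm_nonneg _)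
  rw [mul_pow, hnorm, ← b.sum_sq_norm_inner_left x, Finset.mul_sum]
  refine Finset.sum_le_sum fun i _ => ?_
  rw [Real.norm_eq_abs, sq_abs]
  rcases le_or_gt (i : ℕ) k with hi | hi
  · exact mul_le_mul_of_nonneg_right
      (pow_le_pow_left₀ (T.singularValues_nonneg k) (T.singularValues_antitone hi) 2)
      (sq_nonneg _)
  · rw [hker i hi]; simp

section

variable {a b : Type*} [Fintype a] [Fintype b] [DecidableEq b]

lemma finrank_range_toEuclideanLin (M : Matrix a b ℝ) :
    Module.finrank ℝ (Matrix.toEuclideanLin M).range = M.rank := by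
  classical
  rw [Matrix.rank_eq_finrank_range_toLin M (EuclideanSpace.basisFun a ℝ).toBasis
    (EuclideanSpace.basisFun b ℝ).toBasis, Matrix.toEuclideanLin_eq_toLin_orthonormal]

lemma orthonormal_col {κ : Type*} [DecidableEq κ] {U : Matrix a κ ℝ} (h : Uᵀ * U = 1) :
    Orthonormal ℝ fun i => (WithLp.toLp 2 (U.col i) : EuclideanSpace ℝ a) := by
  rw [orthonormal_iff_ite]
  intro i j
  rw [EuclideanSpace.inner_toLp_toLp]
  have := congrFun (congrFun h i) j
  rw [Matrix.mul_apply, Matrix.one_apply] at this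
  rw [← this]
  simp [dotProduct, mul_comm]

/-- On orthonormal vectors a matrix is bounded by its Frobenius norm. -/
lemma sum_norm_toEuclideanLin_sq_le {κ : Type*} [Fintype κ] (M : Matrix a b ℝ)
    {v : κ → EuclideanSpace ℝ b} (hv : Orthonormal ℝ v) :
    ∑ i, ‖Matrix.toEuclideanLin M (v i)‖ ^ 2 ≤ ∑ r, ∑ j, M r j ^ 2 := by
  have h : ∀ i, ‖Matrix.toEuclideanLin M (v i)‖ ^ 2 =
      ∑ r, inner ℝ (v i) (WithLp.toLp 2 (M r) : EuclideanSpace ℝ b) ^ 2 := by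
    intro i
    rw [EuclideanSpace.real_norm_sq_eq]
    refine Finset.sum_congr rfl fun r _ => ?_
    simp [Matrix.toLpLin_apply, Matrix.mulVec, PiLp.inner_apply, dotProduct]
  simp only [h]
  rw [Finset.sum_comm]
  refine Finset.sum_le_sum fun r _ => (sum_inner_sq_le hv _).trans ?_
  rw [EuclideanSpace.real_norm_sq_eq]

/-- The data that a truncated singular value decomposition with `k ≤ rank M` terms provides:
the truncation `M'` has rank `k`, its image is spanned by left singular vectors `u` of `M`, and the
`k` leading singular values of `M` are at least the smallest positive one of `M'`. -/
lemma IsTruncatedSVD.exists_singular_vectors {k : ℕ} {M M' : Matrix a b ℝ}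
    (h : IsTruncatedSVD k M M') (hk : k ≤ M.rank) (hk0 : 0 < k) :
    M'.rank = k ∧ 0 < sval k M' ∧
    ∃ (u : Fin k → EuclideanSpace ℝ a) (v : Fin k → EuclideanSpace ℝ b) (s : Fin k → ℝ),
      Orthonormal ℝ u ∧ Orthonormal ℝ v ∧
      (∀ i, u i ∈ (Matrix.toEuclideanLin M').range) ∧
      (∀ i, Matrix.toEuclideanLin M (v i) = s i • u i) ∧ ∀ i, sval k M' ≤ s i := by
  obtain ⟨U, V, s, hU, hV, hs, hs0, hM, hM'⟩ := h
  have hkr : k ≤ min (Fintype.card a) (Fintype.card b) :=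
    hk.trans (le_min M.rank_le_card_height M.rank_le_card_width)
  have hrank : ∀ t : Fin (min (Fintype.card a) (Fintype.card b)) → ℝ,
      (U * Matrix.diagonal t * Vᵀ).rank ≤ Fintype.card {i // t i ≠ 0} := by
    intro t
    refine ((Matrix.rank_mul_le_left _ _).trans (Matrix.rank_mul_le_right _ _)).trans ?_
    rw [Matrix.rank_diagonal]
  have hcard : ∀ (j : ℕ) (t : Fin (min (Fintype.card a) (Fintype.card b)) → ℝ),
      (∀ i, j ≤ i.val → t i = 0) → Fintype.card {i // t i ≠ 0} ≤ j := by
    intro j t ht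
    rw [← Fintype.card_fin j]
    refine Fintype.card_le_of_injective
      (fun i => (⟨i.1.1, by by_contra hc; exact i.2 (ht i.1 (by omega))⟩ : Fin j)) ?_
    intro i i' hii
    simpa [Fin.ext_iff, Subtype.ext_iff] using hii
  -- If `sᵢ = 0`, then by monotonicity `M` has rank at most `i`.
  have hpos : ∀ i : Fin (min (Fintype.card a) (Fintype.card b)), i.val < k → 0 < s i := by
    intro i hi
    by_contra hc
    have := (hrank s).trans (hcard i.val s fun j hj =>
      le_antisymm ((hs (Fin.le_def.mpr hj)).trans (not_lt.mp hc)) (hs0 j))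
    rw [← hM] at this
    omega
  have hle : M'.rank ≤ k := by
    rw [hM']
    exact (hrank _).trans (hcard k _ fun i hi => if_neg (by omega))
  have hmul : ∀ (t : Fin (min (Fintype.card a) (Fintype.card b)) → ℝ) i,
      Matrix.toEuclideanLin (U * Matrix.diagonal t * Vᵀ) (WithLp.toLp 2 (V.col i)) =
        t i • (WithLp.toLp 2 (U.col i) : EuclideanSpace ℝ a) := by
    intro t i
    have h1 : Vᵀ *ᵥ V.col i = Pi.single i 1 := by
      rw [← Matrix.mulVec_single_one V, Matrix.mulVec_mulVec, hV, Matrix.one_mulVec]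
    have h2 : (U * Matrix.diagonal t * Vᵀ) *ᵥ V.col i = t i • U.col i := by
      rw [← Matrix.mulVec_mulVec, h1, Matrix.mulVec_single_one]
      ext r
      simp [Matrix.mul_diagonal, mul_comm]
    rw [Matrix.toLpLin_apply, h2, WithLp.toLp_smul]
  let e : Fin k → Fin (min (Fintype.card a) (Fintype.card b)) := Fin.castLE hkr
  have he : Function.Injective e := Fin.castLE_injective hkr
  have hu := (orthonormal_col hU).comp e he
  have hv := (orthonormal_col hV).comp e he
  have hM'e : ∀ i, Matrix.toEuclideanLin M' (WithLp.toLp 2 (V.col (e i))) =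
      s (e i) • (WithLp.toLp 2 (U.col (e i)) : EuclideanSpace ℝ a) := by
    intro i
    rw [hM', hmul, if_pos (show (e i).val < k from i.isLt)]
  have hmem : ∀ i, (WithLp.toLp 2 (U.col (e i)) : EuclideanSpace ℝ a) ∈
      (Matrix.toEuclideanLin M').range := by
    intro i
    refine ⟨(s (e i))⁻¹ • WithLp.toLp 2 (V.col (e i)), ?_⟩
    rw [map_smul, hM'e, inv_smul_smul₀ (hpos (e i) i.isLt).ne']
  have hge : k ≤ M'.rank := by
    rw [← finrank_range_toEuclideanLin]
    have := hu.linearIndependent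
    have h3 := (LinearIndependent.of_comp (v := fun i => (⟨_, hmem i⟩ :
      (Matrix.toEuclideanLin M').range)) (Submodule.subtype _) this).fintype_card_le_finrank
    simpa using h3
  refine ⟨le_antisymm hle hge, ?_, _, _, fun i => s (e i), hu, hv, hmem, ?_, fun i => ?_⟩
  · refine (LinearMap.singularValues_pos_iff_lt_finrank_range _).mpr ?_
    rw [finrank_range_toEuclideanLin]
    omega
  · intro i
    rw [hM]
    exact hmul s (e i)
  · -- As `M'ᵀ uᵢ = sᵢ vᵢ`, the vector `vᵢ` is orthogonal to the kernel of `M'`.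
    have hperp : (WithLp.toLp 2 (V.col (e i)) : EuclideanSpace ℝ b) ∈
        (Matrix.toEuclideanLin M').kerᗮ := by
      intro z hz
      have h1 : Matrix.toEuclideanLin M' z = 0 := hz
      have h2 : inner ℝ (WithLp.toLp 2 (U.col (e i)) : EuclideanSpace ℝ a)
          (Matrix.toEuclideanLin M' z) =
          s (e i) * inner ℝ z (WithLp.toLp 2 (V.col (e i)) : EuclideanSpace ℝ b) := by
        have h3 : M'ᵀ *ᵥ U.col (e i) = s (e i) • V.col (e i) := by
          have h4 : Uᵀ *ᵥ U.col (e i) = Pi.single (e i) 1 := by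
            rw [← Matrix.mulVec_single_one U, Matrix.mulVec_mulVec, hU, Matrix.one_mulVec]
          rw [hM', Matrix.transpose_mul, Matrix.transpose_mul, Matrix.transpose_transpose,
            ← Matrix.mul_assoc, ← Matrix.mulVec_mulVec, h4, Matrix.mulVec_single_one,
            Matrix.diagonal_transpose]
          ext r
          simp only [Matrix.col_apply, Matrix.mul_diagonal, Pi.smul_apply, smul_eq_mul]
          rw [if_pos (show (e i).val < k from i.isLt), mul_comm]
        rw [Matrix.toLpLin_apply, real_inner_comm, EuclideanSpace.inner_eq_star_dotProduct,
          EuclideanSpace.inner_eq_star_dotProduct]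
        simp only [star_trivial]
        rw [Matrix.dotProduct_mulVec, ← Matrix.mulVec_transpose, h3, smul_dotProduct, smul_eq_mul]
      rw [h1, inner_zero_right] at h2
      exact (mul_eq_zero.mp h2.symm).resolve_left (hpos (e i) i.isLt).ne'
    have h5 := singularValues_mul_norm_le (Matrix.toEuclideanLin M') (k := k - 1)
      (by rw [finrank_range_toEuclideanLin]; omega) hperp
    rw [hM'e, norm_smul, (orthonormal_col hV).1, (orthonormal_col hU).1, Real.norm_eq_abs,
      abs_of_pos (hpos (e i) i.isLt), mul_one, mul_one] at h5
    exact h5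

end

/-! ### Finite-length behaviors -/

/-- The state trajectory of `x(t+1) = A x(t) + E u(t)`, `x(0) = x₀`, as a linear function of the
pair `(x₀, u)`. -/
def stateTraj {m n : ℕ} (A : Matrix (Fin n) (Fin n) ℝ) (E : Matrix (Fin n) (Fin m) ℝ) :
    ℕ → (Fin n → ℝ) × (ℕ → Fin m → ℝ) →ₗ[ℝ] (Fin n → ℝ)
  | 0 => LinearMap.fst ℝ _ _
  | t + 1 => A.mulVecLin ∘ₗ stateTraj A E t +
      E.mulVecLin ∘ₗ LinearMap.proj t ∘ₗ LinearMap.snd ℝ _ _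

/-- The signal that the initial state `x₀` and the input `u` generate; the permutation `π` puts
the inputs and the outputs into their places. -/
def stateSignal {m p n : ℕ} (π : Equiv.Perm (Fin m ⊕ Fin p))
    (A : Matrix (Fin n) (Fin n) ℝ) (E : Matrix (Fin n) (Fin m) ℝ)
    (C : Matrix (Fin p) (Fin n) ℝ) (D : Matrix (Fin p) (Fin m) ℝ) :
    (Fin n → ℝ) × (ℕ → Fin m → ℝ) →ₗ[ℝ] Signal (Fin m ⊕ Fin p) where
  toFun z t v := Sum.elim (z.2 t) (C *ᵥ stateTraj A E t z + D *ᵥ z.2 t) (π.symm v)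
  map_add' z z' := by
    ext t v
    rcases h : π.symm v with i | j <;>
      simp [h, Matrix.mulVec_add, add_add_add_comm]
  map_smul' c z := by
    ext t v
    rcases h : π.symm v with i | j <;>
      simp [h, Matrix.mulVec_smul, mul_add]

/-- Extension by zero of an input of length `N`. -/
def padInput (m N : ℕ) : (Fin N → Fin m → ℝ) →ₗ[ℝ] (ℕ → Fin m → ℝ) where
  toFun u t := if h : t < N then u ⟨t, h⟩ else 0
  map_add' u u' := by ext t i; by_cases h : t < N <;> simp [h]
  map_smul' c u := by ext t i; by_cases h : t < N <;> simp [h]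

section StateRep

variable {m p n : ℕ} {B : Submodule ℝ (Signal (Fin m ⊕ Fin p))}
  {π : Equiv.Perm (Fin m ⊕ Fin p)}
  {A : Matrix (Fin n) (Fin n) ℝ} {E : Matrix (Fin n) (Fin m) ℝ}
  {C : Matrix (Fin p) (Fin n) ℝ} {D : Matrix (Fin p) (Fin m) ℝ}

lemma IsStateRep.range_stateSignal (h : IsStateRep B π A E C D) :
    LinearMap.range (stateSignal π A E C D) = B := by
  ext w
  rw [h w, LinearMap.mem_range]
  constructor
  · rintro ⟨z, rfl⟩
    refine ⟨fun t => stateTraj A E t z, fun t => ⟨?_, ?_⟩⟩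
    · simp [stateTraj, stateSignal]
    · ext j; simp [stateSignal]
  · rintro ⟨x, hx⟩
    refine ⟨(x 0, fun t i => w t (π (Sum.inl i))), ?_⟩
    have hst : ∀ t, stateTraj A E t (x 0, fun t i => w t (π (Sum.inl i))) = x t := by
      intro t
      induction t with
      | zero => rfl
      | succ t ih => simp [stateTraj, ih, (hx t).1]
    ext t v
    obtain ⟨v, rfl⟩ := π.surjective v
    rcases v with i | j
    · simp [stateSignal]
    · have := congrFun (hx t).2 j
      simp only [stateSignal, LinearMap.coe_mk, AddHom.coe_mk, Equiv.symm_apply_apply,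
        Sum.elim_inr, hst]
      rw [this]

lemma stateTraj_congr {x₀ : Fin n → ℝ} {u u' : ℕ → Fin m → ℝ} {t : ℕ}
    (h : ∀ s < t, u s = u' s) : stateTraj A E t (x₀, u) = stateTraj A E t (x₀, u') := by
  induction t with
  | zero => rfl
  | succ t ih => simp [stateTraj, ih fun s hs => h s (by omega), h t (by omega)]

lemma IsStateRep.range_window (h : IsStateRep B π A E C D) (N : ℕ) :
    LinearMap.range (window N ∘ₗ stateSignal π A E C D ∘ₗ
      LinearMap.prodMap LinearMap.id (padInput m N)) = restrict B N := by
  ext y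
  rw [restrict, ← h.range_stateSignal]
  constructor
  · rintro ⟨z, rfl⟩
    exact ⟨_, ⟨_, rfl⟩, rfl⟩
  · rintro ⟨_, ⟨⟨x₀, u⟩, rfl⟩, rfl⟩
    refine ⟨(x₀, fun t => u t), ?_⟩
    have hpad : ∀ t < N, padInput m N (fun t => u t) t = u t := by
      intro t ht
      simp [padInput, ht]
    ext ⟨t, v⟩
    have h1 : stateTraj A E t (x₀, padInput m N fun t => u t) = stateTraj A E t (x₀, u) :=
      stateTraj_congr fun s hs => hpad s (hs.trans t.isLt)
    change stateSignal π A E C D (x₀, padInput m N fun t => u t) t v =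
      stateSignal π A E C D (x₀, u) t v
    simp [stateSignal, h1, hpad t t.isLt]

lemma obsMatrix_mulVec_eq_zero_iff {k : ℕ} {x : Fin n → ℝ} :
    obsMatrix A C k *ᵥ x = 0 ↔ ∀ t < k, C *ᵥ (A ^ t *ᵥ x) = 0 := by
  have : ∀ (t : Fin k) j, (obsMatrix A C k *ᵥ x) (t, j) = (C *ᵥ (A ^ (t : ℕ) *ᵥ x)) j := by
    intro t j
    rw [Matrix.mulVec_mulVec]
    rfl
  constructor
  · intro h t ht
    ext j
    rw [← this ⟨t, ht⟩ j, h]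
    rfl
  · intro h
    ext ⟨t, j⟩
    rw [this, h t t.isLt]
    rfl

/-- From the observability index on, vanishing outputs force the initial state to vanish. -/
lemma eq_zero_of_obsMatrix_rank {l N : ℕ} (hl : (obsMatrix A C l).rank = n) (hN : l ≤ N)
    {x : Fin n → ℝ} (hx : ∀ t < N, C *ᵥ (A ^ t *ᵥ x) = 0) : x = 0 := by
  have h0 : obsMatrix A C l *ᵥ x = 0 :=
    obsMatrix_mulVec_eq_zero_iff.mpr fun t ht => hx t (ht.trans_le hN)
  have hker : LinearMap.ker (obsMatrix A C l).mulVecLin = ⊥ := by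
    have h := (obsMatrix A C l).mulVecLin.finrank_range_add_finrank_ker
    rw [← Matrix.rank, hl, Module.finrank_fin_fun] at h
    exact Submodule.finrank_eq_zero.mp (by omega)
  have : x ∈ LinearMap.ker (obsMatrix A C l).mulVecLin := h0
  rwa [hker, Submodule.mem_bot] at this

/-- From the lag on, a trajectory determines its input and its initial state, and these are
free. -/
lemma IsStateRep.finrank_restrict (h : IsStateRep B π A E C D) {l N : ℕ}
    (hl : (obsMatrix A C l).rank = n) (hN : l ≤ N) :
    Module.finrank ℝ (restrict B N) = m * N + n := by
  rw [← h.range_window N, LinearMap.finrank_range_of_inj]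
  · rw [Module.finrank_prod, Module.finrank_fin_fun, Module.finrank_pi_fintype]
    simp only [Module.finrank_fin_fun, Finset.sum_const, Finset.card_univ, Fintype.card_fin,
      smul_eq_mul]
    ring
  rw [← LinearMap.ker_eq_bot, LinearMap.ker_eq_bot']
  rintro ⟨x₀, u⟩ h0
  have hval : ∀ t (ht : t < N) v, stateSignal π A E C D (x₀, padInput m N u) t v = 0 :=
    fun t ht v => congrFun (congrArg WithLp.ofLp h0) (⟨t, ht⟩, v)
  have hpad : ∀ t < N, padInput m N u t = 0 := by
    intro t ht
    ext i
    simpa [stateSignal] using hval t ht (π (Sum.inl i))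
  have hu : u = 0 := by
    ext t i
    simpa [padInput] using congrFun (hpad t t.isLt) i
  subst hu
  have hst : ∀ t, stateTraj A E t (x₀, (0 : ℕ → Fin m → ℝ)) = A ^ t *ᵥ x₀ := by
    intro t
    induction t with
    | zero => simp [stateTraj]
    | succ t ih => simp [stateTraj, ih, Matrix.mulVec_mulVec, pow_succ']
  have hx : x₀ = 0 := by
    refine eq_zero_of_obsMatrix_rank hl hN fun t ht => ?_
    ext j
    have := hval t ht (π (Sum.inr j))
    rw [map_zero] at this
    simpa [stateSignal, hst] using this
  rw [hx]
  rfl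

lemma IsStateRep.shift_mem (h : IsStateRep B π A E C D) {w : Signal (Fin m ⊕ Fin p)} (hw : w ∈ B)
    (s : ℕ) : (fun t => w (t + s)) ∈ B := by
  rw [h] at hw ⊢
  obtain ⟨x, hx⟩ := hw
  exact ⟨fun t => x (t + s), fun t => by simpa [add_right_comm] using hx (t + s)⟩

end StateRep

section LTI

variable {m p n l : ℕ} {B : Submodule ℝ (Signal (Fin m ⊕ Fin p))}

lemma IsLTI.finrank_restrict (hB : IsLTI n l B) {N : ℕ} (hN : l ≤ N) :
    Module.finrank ℝ (restrict B N) = m * N + n := by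
  obtain ⟨π, A, E, C, D, h, hl⟩ := hB.stateRep
  exact h.finrank_restrict hl.1 hN

lemma IsLTI.order_le (hB : IsLTI n l B) : n ≤ p * l := by
  obtain ⟨π, A, E, C, D, h, hl⟩ := hB.stateRep
  have h1 : (obsMatrix A C l).rank = n := hl.1
  rw [← h1, mul_comm]
  simpa using (obsMatrix A C l).rank_le_card_height

/-- The samples `s, …, s + d - 1` of a trajectory of length `N`. -/
def subwindow {ι : Type*} {N d : ℕ} (s : ℕ) (h : s + d ≤ N) (y : Traj N ι) : Traj d ι :=
  WithLp.toLp 2 fun r => y (⟨r.1 + s, by have := r.1.isLt; omega⟩, r.2)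

lemma IsLTI.subwindow_mem (hB : IsLTI n l B) {N d s : ℕ} (h : s + d ≤ N)
    {y : Traj N (Fin m ⊕ Fin p)} (hy : y ∈ restrict B N) :
    subwindow s h y ∈ restrict B d := by
  obtain ⟨π, A, E, C, D, hrep, -⟩ := hB.stateRep
  obtain ⟨w, hw, rfl⟩ := hy
  exact ⟨_, hrep.shift_mem hw s, rfl⟩

end LTI

lemma toEuclideanLin_hankel_single {ι : Type*} {T d : ℕ} (h : d ≤ T) (w : Traj T ι)
    (j : Fin (T - d + 1)) :
    Matrix.toEuclideanLin (hankel h w) (EuclideanSpace.single j 1) =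
      subwindow j (by have := j.isLt; omega) w := by
  ext r
  simp [Matrix.toLpLin_apply, hankel, subwindow]

lemma IsLTI.hankel_mem {m p n l : ℕ} {B : Submodule ℝ (Signal (Fin m ⊕ Fin p))}
    (hB : IsLTI n l B) {T d : ℕ} (hdT : d ≤ T) {w : Traj T (Fin m ⊕ Fin p)}
    (hw : w ∈ restrict B T) (z : EuclideanSpace ℝ (Fin (T - d + 1))) :
    Matrix.toEuclideanLin (hankel hdT w) z ∈ restrict B d := by
  rw [← (EuclideanSpace.basisFun (Fin (T - d + 1)) ℝ).sum_repr z, map_sum]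
  refine Submodule.sum_mem _ fun j _ => ?_
  rw [map_smul, EuclideanSpace.basisFun_apply, toEuclideanLin_hankel_single]
  exact Submodule.smul_mem _ _ (hB.subwindow_mem _ hw)

/-! ### The matrix of shifted annihilators -/

section Shift

variable {ι : Type*} [Fintype ι]

/-- Prepending and appending zero blocks is adjoint to taking a window. -/
lemma shiftedRow_dotProduct {N d s : ℕ} (h : s + d ≤ N) (ρ : Fin d × ι → ℝ) (y : Traj N ι) :
    shiftedRow N s ρ ⬝ᵥ y.ofLp = ρ ⬝ᵥ (subwindow s h y).ofLp := by
  classical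
  let f : Fin d × ι → Fin N × ι := fun r => (⟨r.1 + s, by have := r.1.isLt; omega⟩, r.2)
  have hf : Function.Injective f := by
    rintro ⟨i, v⟩ ⟨j, v'⟩ hij
    simpa [f, Fin.ext_iff] using hij
  have hfρ : ∀ r, shiftedRow N s ρ (f r) = ρ r := by
    rintro ⟨i, v⟩
    simp [shiftedRow, f]
  rw [dotProduct, dotProduct, ← Finset.sum_subset (Finset.subset_univ (Finset.univ.image f)),
    Finset.sum_image fun _ _ _ _ hij => hf hij]
  · exact Finset.sum_congr rfl fun r _ => by rw [hfρ]; rfl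
  · intro k _ hk
    rw [shiftedRow, dif_neg, zero_mul]
    rintro ⟨h1, h2⟩
    refine hk (Finset.mem_image.mpr ⟨(⟨k.1 - s, h2⟩, k.2), Finset.mem_univ _, ?_⟩)
    ext
    · simp [f, h1]
    · rfl

/-- Bessel's inequality for the windows of an orthonormal family: if the windows lie in a subspace
`W`, only the component of `ρ` in `W` matters. -/
lemma sum_inner_subwindow_sq_le {κ : Type*} [Fintype κ] {N d s : ℕ} (h : s + d ≤ N)
    {W : Submodule ℝ (Traj d ι)} {y : κ → Traj N ι} (hy : Orthonormal ℝ y)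
    (hW : ∀ i, subwindow s h (y i) ∈ W) (ρ : Traj d ι) :
    ∑ i, inner ℝ ρ (subwindow s h (y i)) ^ 2 ≤ ‖W.starProjection ρ‖ ^ 2 := by
  set τ := W.starProjection ρ with hτ
  have hinner : ∀ (σ : Traj d ι) (z : Traj N ι), inner ℝ σ (subwindow s h z) =
      inner ℝ (WithLp.toLp 2 (shiftedRow N s σ.ofLp) : Traj N ι) z := by
    intro σ z
    rw [real_inner_comm, real_inner_comm z, EuclideanSpace.inner_eq_star_dotProduct,
      EuclideanSpace.inner_eq_star_dotProduct, star_trivial, star_trivial, dotProduct_comm,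
      dotProduct_comm _ z.ofLp, dotProduct_comm, ← shiftedRow_dotProduct h, dotProduct_comm]
  have hproj : ∀ i, inner ℝ ρ (subwindow s h (y i)) = inner ℝ τ (subwindow s h (y i)) := by
    intro i
    rw [hτ, Submodule.inner_starProjection_left_eq_right,
      Submodule.starProjection_eq_self_iff.mpr (hW i)]
  have hnorm : ‖(WithLp.toLp 2 (shiftedRow N s τ.ofLp) : Traj N ι)‖ ^ 2 = ‖τ‖ ^ 2 := by
    rw [← real_inner_self_eq_norm_sq, ← hinner, ← real_inner_self_eq_norm_sq]
    congr 1
    ext ⟨i, v⟩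
    simp [subwindow, shiftedRow]
  simp only [hproj, hinner]
  simp only [real_inner_comm]
  rw [← hnorm]
  simpa only [real_inner_comm] using sum_inner_sq_le hy
    (WithLp.toLp 2 (shiftedRow N s τ.ofLp) : Traj N ι)

end Shift

/-- The entries of `Γ y` are inner products of rows of `R` with windows of `y`, each at most once;
`p ≤ r` excludes the default value in `gammaMatrix`. -/
lemma norm_toEuclideanLin_gammaMatrix_sq_le {ι : Type*} [Fintype ι] [DecidableEq ι]
    {r d p N : ℕ} (hdN : d ≤ N) (hpr : p ≤ r) (R : Matrix (Fin r) (Fin d × ι) ℝ)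
    (y : Traj N ι) :
    ‖Matrix.toEuclideanLin (gammaMatrix p N R) y‖ ^ 2 ≤
      ∑ s : Fin (N - d + 1), ∑ a, inner ℝ (WithLp.toLp 2 (R a) : Traj d ι)
        (subwindow s (by have := s.isLt; omega) y) ^ 2 := by
  have hrow : ∀ (ρ : Fin d × ι → ℝ) (s : ℕ) (hs : s + d ≤ N),
      shiftedRow N s ρ ⬝ᵥ y.ofLp =
        inner ℝ (WithLp.toLp 2 ρ : Traj d ι) (subwindow s hs y) := by
    intro ρ s hs
    rw [shiftedRow_dotProduct hs, EuclideanSpace.inner_eq_star_dotProduct, star_trivial,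
      dotProduct_comm]
  rw [EuclideanSpace.real_norm_sq_eq, Fintype.sum_sum_type, Fin.sum_univ_succ]
  refine add_le_add (le_of_eq (Finset.sum_congr rfl fun a _ => ?_)) ?_
  · change (shiftedRow N 0 (R a) ⬝ᵥ y.ofLp) ^ 2 = _
    rw [hrow (R a) 0 (by omega)]
    rfl
  · rw [Fintype.sum_prod_type]
    refine Finset.sum_le_sum fun s _ => ?_
    have hs : (s : ℕ) + 1 + d ≤ N := by have := s.isLt; omega
    calc _ = ∑ j : Fin p, inner ℝ (WithLp.toLp 2 (R (Fin.castLE hpr j)) : Traj d ι)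
          (subwindow (s + 1) hs y) ^ 2 := by
          refine Finset.sum_congr rfl fun j _ => ?_
          rw [← hrow _ _ hs]
          change (shiftedRow N (s + 1) (if h : (j : ℕ) < r then R ⟨j, h⟩ else 0) ⬝ᵥ y.ofLp) ^ 2 = _
          rw [dif_pos (j.isLt.trans_le hpr)]
          rfl
      _ = ∑ a ∈ Finset.univ.map (Fin.castLEEmb hpr), inner ℝ (WithLp.toLp 2 (R a) : Traj d ι)
          (subwindow (s + 1) hs y) ^ 2 := by
          rw [Finset.sum_map]
          rfl
      _ ≤ _ := Finset.sum_le_univ_sum_of_nonneg fun a => sq_nonneg _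

/-- If all windows of the orthonormal trajectories `y` lie in `W`, then `Γ` is bounded on `y` by
the components of the rows of `R` in `W`. -/
lemma sum_norm_toEuclideanLin_gammaMatrix_sq_le {ι κ : Type*} [Fintype ι] [DecidableEq ι]
    [Fintype κ] {r d p N : ℕ} (hdN : d ≤ N) (hpr : p ≤ r) (R : Matrix (Fin r) (Fin d × ι) ℝ)
    {W : Submodule ℝ (Traj d ι)} {y : κ → Traj N ι} (hy : Orthonormal ℝ y)
    (hW : ∀ i s (h : s + d ≤ N), subwindow s h (y i) ∈ W) :
    ∑ i, ‖Matrix.toEuclideanLin (gammaMatrix p N R) (y i)‖ ^ 2 ≤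
      ((N - d + 1 : ℕ) : ℝ) * ∑ a, ‖W.starProjection (WithLp.toLp 2 (R a))‖ ^ 2 := by
  calc _ ≤ ∑ i, ∑ s : Fin (N - d + 1), ∑ a, inner ℝ (WithLp.toLp 2 (R a) : Traj d ι)
        (subwindow s (by have := s.isLt; omega) (y i)) ^ 2 :=
        Finset.sum_le_sum fun i _ => norm_toEuclideanLin_gammaMatrix_sq_le hdN hpr R (y i)
    _ = ∑ s : Fin (N - d + 1), ∑ a, ∑ i, inner ℝ (WithLp.toLp 2 (R a) : Traj d ι)
        (subwindow s (by have := s.isLt; omega) (y i)) ^ 2 := by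
        rw [Finset.sum_comm]
        exact Finset.sum_congr rfl fun s _ => Finset.sum_comm
    _ ≤ ∑ _s : Fin (N - d + 1), ∑ a, ‖W.starProjection (WithLp.toLp 2 (R a))‖ ^ 2 :=
        Finset.sum_le_sum fun s _ => Finset.sum_le_sum fun a _ =>
          sum_inner_subwindow_sq_le (by have := s.isLt; omega) hy (fun i => hW i _ _) _
    _ = _ := by simp

/-! ### Perturbation of the left null space -/

/-- A `sin Θ` bound for the left null space of a truncated singular value decomposition `M'` of
`M`, compared with a space `W` whose dimension is the number of the terms kept and which contains
the image of `M₀`. The gap is symmetric, so that it can be measured on the left singular vectors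
`uᵢ = M vᵢ / sᵢ` of `M`; hence only the perturbation `M - M₀` enters and the truncation error
`M - M'` does not. -/
lemma IsTruncatedSVD.sum_norm_starProjection_sq_le {a b c : Type*} [Fintype a] [Fintype b]
    [DecidableEq b] [Fintype c] {k : ℕ} {M M' M₀ : Matrix a b ℝ}
    (h : IsTruncatedSVD k M M') (hk : k ≤ M.rank) (hk0 : 0 < k)
    {W : Submodule ℝ (EuclideanSpace ℝ a)} (hW : Module.finrank ℝ W = k)
    (hM₀ : ∀ z, Matrix.toEuclideanLin M₀ z ∈ W)
    {ρ : c → EuclideanSpace ℝ a} (hρ : Orthonormal ℝ ρ)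
    (hρM : ∀ i, ρ i ∈ ((Matrix.toEuclideanLin M').range)ᗮ) :
    sval k M' ^ 2 * ∑ i, ‖W.starProjection (ρ i)‖ ^ 2 ≤
      ∑ r, ∑ j, (M - M₀) r j ^ 2 := by
  obtain ⟨hrank, hpos, u, v, s, hu, hv, huU, hMv, hs⟩ := h.exists_singular_vectors hk hk0
  set U := (Matrix.toEuclideanLin M').range with hUdef
  have hU : Module.finrank ℝ U = Fintype.card (Fin k) := by
    rw [hUdef, finrank_range_toEuclideanLin, hrank, Fintype.card_fin]
  have hW' : Module.finrank ℝ W = Fintype.card (Fin k) := by rw [hW, Fintype.card_fin]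
  let b₀ := (stdOrthonormalBasis ℝ W).reindex (finCongr hW)
  have hb : Orthonormal ℝ fun i => (b₀ i : EuclideanSpace ℝ a) :=
    b₀.orthonormal.comp_linearIsometry W.subtypeₗᵢ
  have hbW : ∀ i, (b₀ i : EuclideanSpace ℝ a) ∈ W := fun i => (b₀ i).2
  have h1 : ∑ i, ‖W.starProjection (ρ i)‖ ^ 2 ≤
      ∑ j, ‖(b₀ j : EuclideanSpace ℝ a) - U.starProjection (b₀ j)‖ ^ 2 := by
    simp only [norm_starProjection_sq hb hbW hW']
    rw [Finset.sum_comm]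
    refine Finset.sum_le_sum fun j _ => ?_
    refine le_of_eq_of_le (Finset.sum_congr rfl fun i _ => ?_) (sum_inner_sq_le hρ _)
    rw [inner_sub_right, Submodule.inner_left_of_mem_orthogonal (U.starProjection_apply_mem _)
      (hρM i), sub_zero, real_inner_comm]
  rw [sum_norm_sub_starProjection_sq_comm hb hbW hW' hu huU hU] at h1
  refine (mul_le_mul_of_nonneg_left h1 (sq_nonneg _)).trans ?_
  refine le_trans ?_ (sum_norm_toEuclideanLin_sq_le (M - M₀) hv)
  rw [Finset.mul_sum]
  refine Finset.sum_le_sum fun i _ => ?_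
  rw [← mul_pow]
  refine pow_le_pow_left₀ (mul_nonneg hpos.le (norm_nonneg _)) ?_ 2
  calc _ ≤ s i * ‖u i - W.starProjection (u i)‖ :=
        mul_le_mul_of_nonneg_right (hs i) (norm_nonneg _)
    _ = ‖Matrix.toEuclideanLin M (v i) - W.starProjection (Matrix.toEuclideanLin M (v i))‖ := by
        rw [hMv, map_smul, ← smul_sub, norm_smul, Real.norm_eq_abs,
          abs_of_pos (hpos.trans_le (hs i))]
    _ ≤ ‖Matrix.toEuclideanLin M (v i) - Matrix.toEuclideanLin M₀ (v i)‖ :=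
        norm_sub_starProjection_le _ (hM₀ _)
    _ = _ := by rw [map_sub, LinearMap.sub_apply]

lemma sum_hankel_noise_sq_le {m p T d : ℕ} (hdT : d ≤ T) (w : Traj T (Fin m ⊕ Fin p))
    (ε : Fin T → Fin p → ℝ) {εbar : ℝ} (h0 : 0 ≤ εbar) (hε : ∀ t, ‖ε t‖ ≤ εbar) :
    ∑ r, ∑ j, (hankel hdT (addOutputNoise w ε) - hankel hdT w) r j ^ 2 ≤
      (d : ℝ) * (m + p) * ((T - d + 1 : ℕ) : ℝ) * εbar ^ 2 := by
  have hentry : ∀ r j,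
      (hankel hdT (addOutputNoise w ε) - hankel hdT w) r j ^ 2 ≤ εbar ^ 2 := by
    rintro ⟨i, v⟩ j
    rw [sq_le_sq, abs_of_nonneg h0]
    rcases v with v | v
    · simpa [hankel, addOutputNoise] using h0
    · simpa [hankel, addOutputNoise] using (norm_le_pi_norm (ε _) v).trans (hε _)
  refine (Finset.sum_le_sum fun r _ => Finset.sum_le_sum fun j _ => hentry r j).trans ?_
  simp [mul_assoc]

end Behavioral

theorem theorem4 {m p n l T d L k : ℕ}
    (B : Submodule ℝ (Behavioral.Signal (Fin m ⊕ Fin p)))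
    (hB : Behavioral.IsLTI n l B)
    (hpos : 0 < m * d + n) (hdT : d ≤ T) (hld : l + 1 ≤ d) (hdL : d ≤ L)
    -- the exact data, the noise and the noisy data
    (w : Behavioral.Traj T (Fin m ⊕ Fin p)) (hw : w ∈ Behavioral.restrict B T)
    (ε : Fin T → Fin p → ℝ) (εbar : ℝ) (hε : ∀ t, ‖ε t‖ ≤ εbar)
    (hrank : (Behavioral.hankel hdT w).rank = m * d + n)
    (hrank' : m * d + n ≤ (Behavioral.hankel hdT (Behavioral.addOutputNoise w ε)).rank)
    -- the truncated SVD of the noisy Hankel matrix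
    (Hhat : Matrix (Fin d × (Fin m ⊕ Fin p)) (Fin (T - d + 1)) ℝ)
    (hHhat : Behavioral.IsTruncatedSVD (m * d + n)
      (Behavioral.hankel hdT (Behavioral.addOutputNoise w ε)) Hhat)
    -- an orthonormal basis of the left null space, and a basis of the null space of `Γ̂`
    (Rhat : Matrix (Fin (p * d - n)) (Fin d × (Fin m ⊕ Fin p)) ℝ)
    (hRhat : Behavioral.IsNullBasis Hhatᵀ Rhatᵀ) (hRhat' : Rhat * Rhatᵀ = 1)
    (Phat : Matrix (Fin (L + n) × (Fin m ⊕ Fin p)) (Fin k) ℝ)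
    (hPhat : Behavioral.IsNullBasis (Behavioral.gammaMatrix p (L + n) Rhat) Phat)
    (Bhat : Submodule ℝ (Behavioral.Traj (L + n) (Fin m ⊕ Fin p)))
    (hBhat : Bhat = LinearMap.range (Matrix.toEuclideanLin Phat))
    (δ₁ δ₂ : ℝ)
    (hδ₁ : δ₁ = Behavioral.sval (p * (L + n) - n) (Behavioral.gammaMatrix p (L + n) Rhat))
    (hδ₂ : δ₂ = Behavioral.sval (m * d + n) Hhat)
    (hδ₁pos : 0 < δ₁) :
    0 < δ₂ ∧
    (∃ θ : Fin (m * (L + n) + n) → ℝ,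
      Behavioral.IsPrincipalAngles Bhat (Behavioral.restrict B (L + n)) θ) ∧
    ∀ θ : Fin (m * (L + n) + n) → ℝ,
      Behavioral.IsPrincipalAngles Bhat (Behavioral.restrict B (L + n)) θ →
      √(∑ i, Real.sin (θ i) ^ 2) ≤
        8 * √(((m : ℝ) + p) * d * ((L : ℝ) + n - d + 1) * ((m : ℝ) * d + n) * ((T : ℝ) - d + 1))
          / (δ₁ * δ₂) * εbar := by
  set Γ := Behavioral.gammaMatrix p (L + n) Rhat with hΓ
  have hnp : n ≤ p * l := hB.order_le
  have hdN : d ≤ L + n := by omega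
  have hpd : p * l + p ≤ p * d := by
    calc p * l + p = p * (l + 1) := by ring
      _ ≤ p * d := Nat.mul_le_mul_left p hld
  have hpN : p * d + p * (L + n - d) = p * (L + n) := by rw [← Nat.mul_add, Nat.add_sub_cancel' hdN]
  have hrpos : p ≤ p * d - n := by omega
  -- The rank of `Γ̂` is the number of its rows.
  have hΓle : Γ.rank ≤ p * (L + n) - n := by
    refine Γ.rank_le_card_height.trans (le_of_eq ?_)
    rw [Fintype.card_sum, Fintype.card_prod, Fintype.card_fin, Fintype.card_fin, Fintype.card_fin,
      Nat.mul_comm (L + n - d)]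
    omega
  have hΓlt : p * (L + n) - n - 1 < Γ.rank := by
    rw [hδ₁] at hδ₁pos
    rw [← Behavioral.finrank_range_toEuclideanLin]
    exact (LinearMap.singularValues_pos_iff_lt_finrank_range _).mp hδ₁pos
  have hΓrank : Γ.rank = p * (L + n) - n := by omega
  have hBmem : Bhat = (Matrix.toEuclideanLin Γ).ker := by
    ext x
    have h1 : x ∈ Bhat ↔ x.ofLp ∈ LinearMap.range Phat.mulVecLin := by
      rw [hBhat]
      constructor
      · rintro ⟨z, rfl⟩
        exact ⟨z.ofLp, rfl⟩
      · rintro ⟨z, hz⟩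
        exact ⟨WithLp.toLp 2 z, by rw [Matrix.toLpLin_apply, ← Matrix.mulVecLin_apply, hz]⟩
    rw [h1, hPhat.2, LinearMap.mem_ker, LinearMap.mem_ker, Matrix.mulVecLin_apply,
      Matrix.toLpLin_apply, WithLp.toLp_eq_zero]
  have hdimB : Module.finrank ℝ Bhat = m * (L + n) + n := by
    have h : Γ.rank + Module.finrank ℝ Bhat = m * (L + n) + p * (L + n) := by
      rw [hBmem, ← Behavioral.finrank_range_toEuclideanLin,
        LinearMap.finrank_range_add_finrank_ker, finrank_euclideanSpace, Fintype.card_prod,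
        Fintype.card_sum, Fintype.card_fin, Fintype.card_fin, Fintype.card_fin]
      ring
    omega
  have hdimB' : Module.finrank ℝ (Behavioral.restrict B (L + n)) = m * (L + n) + n :=
    hB.finrank_restrict (by omega)
  -- There is at least one sample, as `l + 1 ≤ d ≤ T`, so the noise bound is nonnegative.
  have hε0 : 0 ≤ εbar := (norm_nonneg _).trans (hε ⟨0, by omega⟩)
  have hδ₂pos : 0 < δ₂ := by
    rw [hδ₂]
    exact (hHhat.exists_singular_vectors hrank' hpos).2.1
  refine ⟨hδ₂pos, Behavioral.exists_isPrincipalAngles hdimB hdimB', fun θ hθ => ?_⟩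
  obtain ⟨y, hy, hyB, hsin⟩ := hθ.exists_orthonormal
  -- The rows of `R̂` are orthonormal and orthogonal to the image of the truncated Hankel matrix.
  have hR : Orthonormal ℝ fun a => (WithLp.toLp 2 (Rhat a) :
      Behavioral.Traj d (Fin m ⊕ Fin p)) :=
    Behavioral.orthonormal_col (U := Rhatᵀ) hRhat'
  have hRperp : ∀ a, (WithLp.toLp 2 (Rhat a) : Behavioral.Traj d (Fin m ⊕ Fin p)) ∈
      ((Matrix.toEuclideanLin Hhat).range)ᗮ := by
    intro a
    have h1 : Rhat a ∈ LinearMap.ker Hhatᵀ.mulVecLin := by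
      rw [← hRhat.2]
      exact ⟨Pi.single a 1, by rw [Matrix.mulVecLin_apply, Matrix.mulVec_single_one]; rfl⟩
    rw [LinearMap.mem_ker, Matrix.mulVecLin_apply, Matrix.mulVec_transpose] at h1
    rintro _ ⟨z, rfl⟩
    rw [Matrix.toLpLin_apply, EuclideanSpace.inner_eq_star_dotProduct, star_trivial,
      Matrix.dotProduct_mulVec, h1, zero_dotProduct]
  have hgap := hHhat.sum_norm_starProjection_sq_le hrank' hpos
    (hB.finrank_restrict (by omega)) (hB.hankel_mem hdT hw) hR hRperp
  rw [← hδ₂] at hgap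
  have hnoise := hgap.trans (Behavioral.sum_hankel_noise_sq_le hdT w ε hε0 hε)
  have hΓy := Behavioral.sum_norm_toEuclideanLin_gammaMatrix_sq_le (p := p) hdN hrpos Rhat hy
    (W := Behavioral.restrict B d) fun i s h => hB.subwindow_mem h (hyB i)
  have hlow : δ₁ ^ 2 * ∑ i, Real.sin (θ i) ^ 2 ≤
      ∑ i, ‖Matrix.toEuclideanLin Γ (y i)‖ ^ 2 := by
    rw [Finset.mul_sum]
    refine Finset.sum_le_sum fun i _ => ?_
    rw [hsin, ← mul_pow]
    refine pow_le_pow_left₀ (mul_nonneg hδ₁pos.le (norm_nonneg _)) ?_ 2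
    have h1 : Matrix.toEuclideanLin Γ (y i - Bhat.starProjection (y i)) =
        Matrix.toEuclideanLin Γ (y i) := by
      have h2 : Bhat.starProjection (y i) ∈ (Matrix.toEuclideanLin Γ).ker := by
        rw [← hBmem]
        exact Bhat.starProjection_apply_mem _
      rw [map_sub, LinearMap.mem_ker.mp h2, sub_zero]
    rw [← h1, hδ₁]
    refine Behavioral.singularValues_mul_norm_le _ ?_ ?_
    · rw [Behavioral.finrank_range_toEuclideanLin]
      omega
    · rw [← hBmem]
      exact Bhat.sub_starProjection_mem_orthogonal _
  have hTd : ((T - d + 1 : ℕ) : ℝ) = (T : ℝ) - d + 1 := by push_cast [Nat.cast_sub hdT]; ring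
  have hNd : ((L + n - d + 1 : ℕ) : ℝ) = (L : ℝ) + n - d + 1 := by
    rw [Nat.cast_add, Nat.cast_sub hdN, Nat.cast_add]; push_cast; ring
  rw [hTd] at hnoise
  rw [hNd] at hΓy
  have hTd0 : (0 : ℝ) ≤ (T : ℝ) - d + 1 := by rw [← hTd]; positivity
  have hNd0 : (0 : ℝ) ≤ (L : ℝ) + n - d + 1 := by rw [← hNd]; positivity
  set S := ∑ i, Real.sin (θ i) ^ 2 with hS
  set G := ∑ a, ‖(Behavioral.restrict B d).starProjection (WithLp.toLp 2 (Rhat a))‖ ^ 2 with hG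
  set t := (T : ℝ) - d + 1 with ht
  set c := (L : ℝ) + n - d + 1 with hc
  have hK0 : (0 : ℝ) ≤ c * (d * (m + p) * t) := by positivity
  have hmain : δ₁ ^ 2 * δ₂ ^ 2 * S ≤ c * (d * (m + p) * t) * εbar ^ 2 := by
    calc δ₁ ^ 2 * δ₂ ^ 2 * S = δ₂ ^ 2 * (δ₁ ^ 2 * S) := by ring
      _ ≤ δ₂ ^ 2 * (c * G) := mul_le_mul_of_nonneg_left (hlow.trans hΓy) (sq_nonneg _)
      _ = c * (δ₂ ^ 2 * G) := by ring
      _ ≤ c * (d * (m + p) * t * εbar ^ 2) := mul_le_mul_of_nonneg_left hnoise hNd0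
      _ = _ := by ring
  have hone : (1 : ℝ) ≤ (m : ℝ) * d + n := by exact_mod_cast hpos
  refine Real.sqrt_le_iff.mpr ⟨by positivity, ?_⟩
  rw [mul_pow, div_pow, mul_pow, Real.sq_sqrt (by positivity), div_mul_eq_mul_div,
    le_div_iff₀ (by positivity)]
  calc S * (δ₁ * δ₂) ^ 2 = δ₁ ^ 2 * δ₂ ^ 2 * S := by ring
    _ ≤ c * (d * (m + p) * t) * εbar ^ 2 * 1 := by rw [mul_one]; exact hmain
    _ ≤ c * (d * (m + p) * t) * εbar ^ 2 * (8 ^ 2 * ((m : ℝ) * d + n)) :=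
        mul_le_mul_of_nonneg_left (by linarith) (mul_nonneg hK0 (sq_nonneg _))
    _ = _ := by ring
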